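/- Let $\mathcal D$ be the family of dyadic intervals $[j2^n,(j+1)2^n)$, $j,n\in\mathbb Z$, of $\mathbb R$. For $I\in\mathcal D$ let $h_I=|I|^{-1/2}(\mathbf 1_{I_-}-\mathbf 1_{I_+})$, where $I_-$ and $I_+$ are the left and right halves of $I$, and for a dyadic rectangle $R=I\times J\in\mathcal D\times\mathcal D$ let $h_R=h_I\otimes h_J$. For a real sequence $\sigma=(\sigma_R)_{R\in\mathcal D\times\mathcal D}$ with $|\sigma_R|\le 1$ for all $R$, the bi-parameter martingale transform $T_\sigma$ is $$T_\sigma f=\sum_{R\in\mathcal D\times\mathcal D}\sigma_R\,\langle f,h_R\rangle\,h_R ,$$ the sum converging unconditionally in $L^2(\mathbb R^2)$ for $f\in L^2(\mathbb R^2)$. Write $\langle f\rangle_R=\frac1{|R|}\int_R f$. A collection $\mathcal S$ of dyadic rectangles is $\eta$-sparse if there are pairwise disjoint measurable sets $E(R)\subseteq R$, $R\in\mathcal S$, with $|E(R)|\ge\eta|R|$ for all $R\in\mathcal S$. Corollary. There is no $(1,1)$ sparse domination, with uniform constants, for all bi-parameter martingale transforms. That is: for every $C>0$ and every $0<\eta\le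 1$ there exist a real sequence $\sigma$ with $|\sigma_R|\le1$ for all $R$ and bounded, measurable, compactly supported functions $f,g:\mathbb R^2\to\mathbb R$ such that $$|\langle T_\sigma f,g\rangle| > C\sum_{R\in\mathcal S}\langle |f|\rangle_R\,\langle |g|\rangle_R\,|R|$$ for every $\eta$-sparse collection $\mathcal S$ of dyadic rectangles. -/

import Mathlib

open MeasureTheory Set
open scoped ENNReal

/-- The dyadic interval `[index * 2 ^ scale, (index + 1) * 2 ^ scale)` of the line; distinct pairs
of integers give distinct intervals. -/
@[ext] structure DyadicInterval where
  scale : ℤ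
  index : ℤ

namespace DyadicInterval

noncomputable def length (I : DyadicInterval) : ℝ := (2 : ℝ) ^ I.scale

noncomputable def left (I : DyadicInterval) : ℝ := I.index * I.length

noncomputable def mid (I : DyadicInterval) : ℝ := I.left + I.length / 2

noncomputable def right (I : DyadicInterval) : ℝ := I.left + I.length

/-- The underlying half-open interval. -/
noncomputable def toSet (I : DyadicInterval) : Set ℝ := Ico I.left I.right

/-- The `L²`-normalized Haar function `h_I = |I|^(-1/2) (1_{left half} - 1_{right half})`. -/
noncomputable def haar (I : DyadicInterval) (x : ℝ) : ℝ :=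
  (Real.sqrt I.length)⁻¹ *
    ((Ico I.left I.mid).indicator 1 x - (Ico I.mid I.right).indicator 1 x)

theorem memLp_haar (I : DyadicInterval) : MemLp I.haar 2 volume := by
  have h : ∀ a b : ℝ, MemLp ((Ico a b).indicator (1 : ℝ → ℝ)) 2 volume := fun a b =>
    memLp_indicator_const 2 measurableSet_Ico (1 : ℝ) (Or.inr (by simp))
  exact ((h _ _).sub (h _ _)).const_mul _

end DyadicInterval

/-- A dyadic rectangle `I × J` of the plane, with sides parallel to the axes and arbitrary
eccentricity. -/
@[ext] structure DyadicRectangle where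
  fst : DyadicInterval
  snd : DyadicInterval

namespace DyadicRectangle

/-- The underlying subset of the plane. -/
noncomputable def toSet (R : DyadicRectangle) : Set (ℝ × ℝ) := R.fst.toSet ×ˢ R.snd.toSet

/-- The bi-parameter Haar function `h_R = h_I ⊗ h_J` of `R = I × J`. -/
noncomputable def haar (R : DyadicRectangle) (p : ℝ × ℝ) : ℝ :=
  R.fst.haar p.1 * R.snd.haar p.2

theorem memLp_haar (R : DyadicRectangle) : MemLp R.haar 2 volume := by
  have h1 := R.fst.memLp_haar
  have h2 := R.snd.memLp_haar
  have hm : AEStronglyMeasurable R.haar volume := by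
    rw [Measure.volume_eq_prod]
    exact (h1.1.comp_fst).mul (h2.1.comp_snd)
  rw [memLp_two_iff_integrable_sq hm, Measure.volume_eq_prod]
  have := ((memLp_two_iff_integrable_sq h1.1).1 h1).mul_prod
    ((memLp_two_iff_integrable_sq h2.1).1 h2)
  simpa only [haar, mul_pow] using this

/-- The average `⟨|f|⟩_R` of `|f|` over `R`. -/
noncomputable def average (f : ℝ × ℝ → ℝ) (R : DyadicRectangle) : ℝ≥0∞ :=
  (∫⁻ x in R.toSet, ‖f x‖ₑ) / volume R.toSet

end DyadicRectangle

/-- The bi-parameter martingale transform `T_σ f = ∑_R σ_R ⟨f, h_R⟩ h_R`, the sum being the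
unconditional sum in `L²(ℝ²)` over all dyadic rectangles (it converges for every `f` in `L²` and
every bounded `σ`, the functions `h_R` being orthonormal). -/
noncomputable def martingaleTransform (σ : DyadicRectangle → ℝ) (f : ℝ × ℝ → ℝ) :
    Lp ℝ 2 (volume : Measure (ℝ × ℝ)) :=
  ∑' R : DyadicRectangle, (σ R * ∫ x, f x * R.haar x) • R.memLp_haar.toLp R.haar

/-- A collection `S` of dyadic rectangles is `η`-sparse if the rectangles `R ∈ S` have pairwise
disjoint measurable subsets `E R` with `|E R| ≥ η |R|`. -/
def IsSparse (η : ℝ) (S : Set DyadicRectangle) : Prop :=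
  ∃ E : DyadicRectangle → Set (ℝ × ℝ),
    (∀ R ∈ S, MeasurableSet (E R) ∧ E R ⊆ R.toSet ∧
      ENNReal.ofReal η * volume R.toSet ≤ volume (E R)) ∧
    S.PairwiseDisjoint E

/-- The `(1,1)` sparse form `∑_{R ∈ S} ⟨|f|⟩_R ⟨|g|⟩_R |R|`, possibly infinite. -/
noncomputable def sparseForm (S : Set DyadicRectangle) (f g : ℝ × ℝ → ℝ) : ℝ≥0∞ :=
  ∑' R : S, R.1.average f * R.1.average g * volume R.1.toSet

/-! Both functions are normalized sums of squares of side `2 ^ (-m)` in the unit square, coded by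
words of length `m`: one coordinate reads its digits forwards, the other backwards. A dyadic
rectangle then prescribes a prefix of the first word and a suffix of the second. For `f` the two
words agree (a digit-reversal net). For `g` they agree exactly on a window of length `k`, and the
window is averaged over `M` positions.

Upper bound: if prefix and suffix do not overlap, equidistribution bounds both averages by 1. If
they overlap, `f` makes the prescriptions equal there, so a square of `g` can meet the rectangle
only if its window contains the overlap. This leaves an overlap of at most `k` and at most `k`
windows, so `M = k * 4 ^ k` pays for the loss (`card_mul_card_le`). Hence `⟨|f|⟩_R ⟨|g|⟩_R` lies
below a fixed integrable weight on `R`, and every sparse form is at most its integral over `η`.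

Lower bound: a rectangle whose overlap is exactly one window meets one square of `f` and one of `g`,
so no cancellation occurs in its Haar coefficients. There are `M * 2 ^ m` such rectangles, each
contributing `2 ^ k / (M * 2 ^ m)`; with matching signs the pairing is `2 ^ k`, which is unbounded.
-/

namespace DyadicInterval

/-! ### Dyadic intervals, Haar functions and binary digits -/

theorem length_pos (I : DyadicInterval) : 0 < I.length := zpow_pos (by norm_num) _

theorem mem_toSet_iff (I : DyadicInterval) (x : ℝ) :
    x ∈ I.toSet ↔ ⌊x / I.length⌋ = I.index := by
  have h := I.length_pos
  rw [Int.floor_eq_iff, toSet, mem_Ico, right, left, le_div_iff₀ h, div_lt_iff₀ h, add_mul, one_mul]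

theorem volume_toSet (I : DyadicInterval) : volume I.toSet = ENNReal.ofReal I.length := by
  simp [toSet, right]

theorem measurableSet_toSet (I : DyadicInterval) : MeasurableSet I.toSet := measurableSet_Ico

theorem haar_of_mem_left {I : DyadicInterval} {x : ℝ} (h : x ∈ Ico I.left I.mid) :
    I.haar x = (Real.sqrt I.length)⁻¹ := by
  have h' : x ∉ Ico I.mid I.right := fun h' => absurd h'.1 (not_le.2 h.2)
  simp [haar, h, h']

theorem haar_of_mem_right {I : DyadicInterval} {x : ℝ} (h : x ∈ Ico I.mid I.right) :
    I.haar x = -(Real.sqrt I.length)⁻¹ := by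
  have h' : x ∉ Ico I.left I.mid := fun h' => absurd h'.2 (not_lt.2 h.1)
  simp [haar, h, h']

theorem haar_of_notMem {I : DyadicInterval} {x : ℝ} (h : x ∉ I.toSet) : I.haar x = 0 := by
  have hl := I.length_pos
  have h1 : x ∉ Ico I.left I.mid := fun h' => h ⟨h'.1, h'.2.trans (by simp [mid, right]; linarith)⟩
  have h2 : x ∉ Ico I.mid I.right := fun h' => h ⟨le_trans (by simp [mid]; linarith) h'.1, h'.2⟩
  simp [haar, h1, h2]

/-- The integer whose `n` binary digits are `u 0, …, u (n - 1)`, leading digit first. -/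
def bitIndex (u : ℕ → Bool) : ℕ → ℤ
  | 0 => 0
  | n + 1 => 2 * bitIndex u n + if u n then 1 else 0

/-- The dyadic interval of length `2 ^ (-n)` in `[0, 1)` consisting of the points whose first
binary digits are `u 0, …, u (n - 1)`. -/
def cell (u : ℕ → Bool) (n : ℕ) : DyadicInterval := ⟨-n, bitIndex u n⟩

theorem length_cell (u : ℕ → Bool) (n : ℕ) : (cell u n).length = (2 ^ n : ℝ)⁻¹ := by
  simp [length, cell]

theorem bitIndex_eq_iff {u v : ℕ → Bool} {n : ℕ} :
    bitIndex u n = bitIndex v n ↔ ∀ i < n, u i = v i := by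
  induction n with
  | zero => simp [bitIndex]
  | succ n ih =>
    simp only [bitIndex, Nat.forall_lt_succ_right, ← ih]
    cases u n <;> cases v n <;> simp <;> omega

theorem cell_eq_iff {u v : ℕ → Bool} {n : ℕ} : cell u n = cell v n ↔ ∀ i < n, u i = v i := by
  simp [cell, ← bitIndex_eq_iff]

theorem mem_cell_iff {u : ℕ → Bool} {n : ℕ} {x : ℝ} :
    x ∈ (cell u n).toSet ↔ ⌊x * 2 ^ n⌋ = bitIndex u n := by
  rw [mem_toSet_iff, length_cell, div_inv_eq_mul, cell]

theorem cell_succ_subset_half (u : ℕ → Bool) (n : ℕ) :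
    (cell u (n + 1)).toSet ⊆ if u n then Ico (cell u n).mid (cell u n).right
      else Ico (cell u n).left (cell u n).mid := by
  intro x
  have h2 : (2 ^ n : ℝ) ≠ 0 := by positivity
  have e : ((2 : ℝ) ^ (n + 1))⁻¹ = (2 ^ n : ℝ)⁻¹ / 2 := by rw [pow_succ]; field_simp
  simp only [toSet, mem_Ico, right, left, mid, length_cell, e]
  simp only [cell, bitIndex]
  rintro ⟨h1, h2⟩
  split_ifs at h1 h2 ⊢ <;> push_cast at h1 h2 <;> constructor <;> linarith

theorem cell_succ_subset (u : ℕ → Bool) (n : ℕ) : (cell u (n + 1)).toSet ⊆ (cell u n).toSet := by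
  have hl := (cell u n).length_pos
  refine (cell_succ_subset_half u n).trans ?_
  split_ifs
  · exact Ico_subset_Ico_left (by simp [mid]; linarith)
  · exact Ico_subset_Ico_right (by simp [mid, right]; linarith)

theorem cell_antitone (u : ℕ → Bool) : Antitone fun n => (cell u n).toSet :=
  antitone_nat_of_succ_le (cell_succ_subset u)

/-- As `a < m`, the smaller cell lies in a single half of the larger one, where the Haar function is
constant. The digit `v a` only decides the sign. -/
theorem setIntegral_haar_cell {u v : ℕ → Bool} {a m : ℕ} (ham : a < m) (h : ∀ i < a, v i = u i) :
    |∫ x in (cell v m).toSet, (cell u a).haar x| =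
      (Real.sqrt (cell u a).length)⁻¹ * (2 ^ m : ℝ)⁻¹ := by
  have hc : cell u a = cell v a := cell_eq_iff.2 fun i hi => (h i hi).symm
  have hs := (cell_antitone v (Nat.succ_le_of_lt ham)).trans (cell_succ_subset_half v a)
  have hv : volume.real (cell v m).toSet = (2 ^ m : ℝ)⁻¹ := by
    rw [Measure.real, volume_toSet, ENNReal.toReal_ofReal (length_pos _).le, length_cell]
  have hn : (0 : ℝ) ≤ (Real.sqrt (cell v a).length)⁻¹ := by positivity
  rw [hc]
  cases hva : v a
  · simp only [hva] at hs
    rw [setIntegral_congr_fun (g := fun _ => (Real.sqrt (cell v a).length)⁻¹)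
      (measurableSet_toSet _) (fun x hx => haar_of_mem_left (by simpa using hs hx)),
      setIntegral_const, hv, smul_eq_mul, abs_of_nonneg (by positivity), mul_comm]
  · simp only [hva] at hs
    rw [setIntegral_congr_fun (g := fun _ => -(Real.sqrt (cell v a).length)⁻¹)
      (measurableSet_toSet _) (fun x hx => haar_of_mem_right (by simpa using hs hx)),
      setIntegral_const, hv, smul_eq_mul, mul_neg, abs_neg, abs_of_nonneg (by positivity), mul_comm]

theorem setIntegral_haar_cell_eq_zero {u v : ℕ → Bool} {a m : ℕ} (ham : a ≤ m)
    (h : ¬ ∀ i < a, v i = u i) : ∫ x in (cell v m).toSet, (cell u a).haar x = 0 := by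
  refine setIntegral_eq_zero_of_forall_eq_zero fun x hx => haar_of_notMem fun hx' => h ?_
  have := cell_antitone v ham hx
  rw [mem_cell_iff] at hx' this
  exact bitIndex_eq_iff.1 (this.symm.trans hx')

/-- The number of bisections of `[0, 1)` leading to an interval of the length of `I`. -/
def depth (I : DyadicInterval) : ℕ := (-I.scale).toNat

/-- All points of `I` share their first `depth` digits. The restriction to `[0, 1)` matters for `n =
0`, since `I` may be longer than 1 and `depth` is truncated at 0. -/
theorem floor_mul_two_pow_eq {I : DyadicInterval} {x y : ℝ} (hx : x ∈ I.toSet) (hy : y ∈ I.toSet)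
    {n : ℕ} (hn : n ≤ I.depth) (hx0 : x ∈ Ico (0 : ℝ) 1) (hy0 : y ∈ Ico (0 : ℝ) 1) :
    ⌊x * 2 ^ n⌋ = ⌊y * 2 ^ n⌋ := by
  rcases Nat.eq_zero_or_pos n with rfl | hpos
  · simp only [pow_zero, mul_one]
    rw [Int.floor_eq_zero_iff.2 hx0, Int.floor_eq_zero_iff.2 hy0]
  obtain ⟨d, hd⟩ := Nat.exists_eq_add_of_le hn
  have hs : I.scale = -((n + d : ℕ) : ℤ) := by rw [depth] at hd hn; omega
  have hl : I.length = (2 ^ (n + d) : ℝ)⁻¹ := by rw [length, hs, zpow_neg, zpow_natCast]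
  have key : ∀ z ∈ I.toSet, ⌊z * 2 ^ n⌋ = I.index / ((2 ^ d : ℕ) : ℤ) := by
    intro z hz
    rw [mem_toSet_iff, hl, div_inv_eq_mul] at hz
    rw [← hz, ← Int.floor_div_natCast]
    congr 1
    push_cast
    rw [pow_add]
    field_simp
  rw [key x hx, key y hy]

theorem cell_subset_unit (u : ℕ → Bool) (n : ℕ) : (cell u n).toSet ⊆ Ico (0 : ℝ) 1 := by
  refine (cell_antitone u (Nat.zero_le n)).trans ?_
  simp [toSet, left, right, cell, bitIndex, length]

/-- Turns incidence with an interval into a condition on words: a side of a rectangle prescribes an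
initial segment of digits. -/
theorem exists_digits (I : DyadicInterval) (m : ℕ) :
    ∃ α : ℕ → Bool, ∀ u : ℕ → Bool, ((cell u m).toSet ∩ I.toSet).Nonempty →
      ∀ i < min I.depth m, u i = α i := by
  by_cases h : ∃ α, ((cell α m).toSet ∩ I.toSet).Nonempty
  · obtain ⟨α, x, hx, hxI⟩ := h
    refine ⟨α, ?_⟩
    rintro u ⟨y, hy, hyI⟩
    rw [← bitIndex_eq_iff, ← mem_cell_iff.1 (cell_antitone u (min_le_right _ m) hy),
      ← mem_cell_iff.1 (cell_antitone α (min_le_right _ m) hx)]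
    exact floor_mul_two_pow_eq hyI hxI (min_le_left _ _) (cell_subset_unit _ _ hy)
      (cell_subset_unit _ _ hx)
  · exact ⟨fun _ => false, fun u hu => absurd ⟨u, hu⟩ h⟩

theorem volume_cell_inter_le (I : DyadicInterval) (u : ℕ → Bool) (m : ℕ) :
    volume ((cell u m).toSet ∩ I.toSet) ≤
      ENNReal.ofReal ((2 ^ min I.depth m : ℝ) * (2 ^ I.depth : ℝ)⁻¹ * (2 ^ m : ℝ)⁻¹) := by
  rcases le_or_gt I.depth m with h | h
  · rw [min_eq_left h, mul_inv_cancel₀ (by positivity), one_mul, ← length_cell u m,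
      ← volume_toSet]
    exact measure_mono inter_subset_left
  · rw [min_eq_right h.le, mul_right_comm, mul_inv_cancel₀ (by positivity), one_mul]
    refine (measure_mono inter_subset_right).trans ?_
    rw [volume_toSet]
    apply ENNReal.ofReal_le_ofReal
    rw [length, ← zpow_natCast, ← zpow_neg]
    exact zpow_le_zpow_right₀ (by norm_num) (by rw [depth] at *; omega)

/-- Up to the factor `5`, the squared proportion of `I` that lies in `[0, 1)`, for an `I`
meeting `[0, 1)`, is dominated at all points of `I` by the Cauchy weight. -/
theorem inv_depth_le {I : DyadicInterval} {x y : ℝ} (hx : x ∈ I.toSet) (hy : y ∈ I.toSet)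
    (hy0 : y ∈ Ico (0 : ℝ) 1) :
    ((2 ^ I.depth : ℝ)⁻¹) ^ 2 ≤ 5 * (1 + x ^ 2)⁻¹ * I.length ^ 2 := by
  have hl := I.length_pos
  have hxy : |x| ≤ 1 + I.length := by
    simp only [toSet, right, mem_Ico] at hx hy
    rw [abs_le]
    constructor <;> linarith [hx.1, hx.2, hy.1, hy.2, hy0.1, hy0.2]
  have hsq : x ^ 2 ≤ (1 + I.length) ^ 2 := sq_le_sq' (by linarith [neg_abs_le x]) (by linarith [le_abs_self x])
  have h1 : 0 < 1 + x ^ 2 := by positivity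
  rw [mul_right_comm, ← div_eq_mul_inv, le_div_iff₀ h1]
  rcases le_or_gt 0 I.scale with h | h
  · have hd : I.depth = 0 := by rw [depth]; omega
    have : 1 ≤ I.length := one_le_zpow₀ (by norm_num) h
    rw [hd]; norm_num; nlinarith
  · have hd : (2 ^ I.depth : ℝ)⁻¹ = I.length := by
      rw [length, ← zpow_natCast, ← zpow_neg]; congr 1; rw [depth]; omega
    have : I.length ≤ 1 := zpow_le_one_of_nonpos₀ (by norm_num) h.le
    rw [hd, mul_comm]
    gcongr
    nlinarith

end DyadicInterval

/-! ### Counting words with prescribed prefix and suffix -/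

/-- Only the middle positions are free. By truncated subtraction the bound is 1 once prefix and
suffix cover the word. -/
theorem card_filter_eq_on_ends_le {m a b : ℕ} (α β : Fin m → Bool) :
    (Finset.univ.filter fun u : Fin m → Bool => (∀ i : Fin m, (i : ℕ) < a → u i = α i) ∧
      ∀ i : Fin m, m ≤ i + b → u i = β i).card ≤ 2 ^ (m - b - a) := by
  let F := {i : Fin m // a ≤ (i : ℕ) ∧ (i : ℕ) + b < m}
  have hF : Fintype.card F ≤ m - b - a := by
    rw [← Nat.card_Ico, ← Fintype.card_coe]
    refine Fintype.card_le_of_injective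
      (fun i : F => (⟨i.1, Finset.mem_Ico.2 ⟨i.2.1, by have := i.2.2; omega⟩⟩ :
        Finset.Ico a (m - b))) fun i j h => ?_
    exact Subtype.ext (Fin.ext (congrArg Subtype.val h))
  calc _ ≤ (Finset.univ : Finset (F → Bool)).card := by
        refine Finset.card_le_card_of_injOn (fun u i => u i.1) (fun _ _ => Finset.mem_univ _) ?_
        intro u hu v hv h
        simp only [Finset.coe_filter, Finset.mem_univ, true_and, mem_ofPred_eq] at hu hv
        funext i
        by_cases h1 : (i : ℕ) < a
        · rw [hu.1 i h1, hv.1 i h1]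
        by_cases h2 : m ≤ i + b
        · rw [hu.2 i h2, hv.2 i h2]
        · exact congrFun h ⟨i, by omega, by omega⟩
    _ = 2 ^ Fintype.card F := by simp
    _ ≤ _ := Nat.pow_le_pow_right (by norm_num) hF

/-- The word with zeros exactly at the `k` positions `t + 1, …, t + k`. -/
def windowWord (k t i : ℕ) : Bool := !decide (t + 1 ≤ i ∧ i < t + 1 + k)

theorem windowWord_eq_false {k t i : ℕ} : windowWord k t i = false ↔ t + 1 ≤ i ∧ i < t + 1 + k := by
  simp [windowWord]

/-- The combinatorial core: neither count is controlled well enough alone, but when prefix and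
suffix overlap, both being nonzero confines the overlap to a window. -/
theorem card_mul_card_le {k M m a b : ℕ} (hk : k * 4 ^ k ≤ M) (ha : a ≤ m) (hb : b ≤ m)
    (α β : Fin m → Bool) :
    (Finset.univ.filter fun u : Fin m → Bool => (∀ i : Fin m, (i : ℕ) < a → u i = α i) ∧
      ∀ i : Fin m, m ≤ i + b → u i = β i).card *
    (Finset.univ.filter fun p : Fin M × (Fin m → Bool) =>
      (∀ i : Fin m, (i : ℕ) < a → p.2 i = α i) ∧
      ∀ i : Fin m, m ≤ i + b → xor (p.2 i) (windowWord k p.1 i) = β i).card * 4 ^ (a + b)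
    ≤ M * 4 ^ m := by
  set U := Finset.univ.filter fun u : Fin m → Bool => (∀ i : Fin m, (i : ℕ) < a → u i = α i) ∧
      ∀ i : Fin m, m ≤ i + b → u i = β i with hU
  set V := Finset.univ.filter fun p : Fin M × (Fin m → Bool) =>
      (∀ i : Fin m, (i : ℕ) < a → p.2 i = α i) ∧
      ∀ i : Fin m, m ≤ i + b → xor (p.2 i) (windowWord k p.1 i) = β i with hV
  have hUc : U.card ≤ 2 ^ (m - b - a) := card_filter_eq_on_ends_le α β
  -- For a fixed window, the condition again prescribes both ends of the word, with `β` altered by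
  -- the window.
  have hVc : ∀ T : Finset (Fin M), (∀ p ∈ V, p.1 ∈ T) → V.card ≤ 2 ^ (m - b - a) * T.card := by
    intro T hT
    refine Finset.card_le_mul_card_image_of_maps_to hT _ fun t _ => ?_
    refine le_trans (Finset.card_le_card_of_injOn (fun p => p.2) ?_ ?_)
      (card_filter_eq_on_ends_le (m := m) (a := a) (b := b) α
        (fun i => xor (β i) (windowWord k t i)))
    · intro p hp
      simp only [hV, Finset.coe_filter, Finset.mem_filter, Finset.mem_univ, true_and,
        mem_ofPred_eq] at hp ⊢
      refine ⟨hp.1.1, fun i hi => ?_⟩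
      rw [← hp.1.2 i hi, hp.2]
      simp
    · intro p hp q hq h
      simp only [Finset.coe_filter, mem_ofPred_eq] at hp hq
      exact Prod.ext (hp.2.trans hq.2.symm) h
  rcases le_or_gt (a + b) m with hab | hab
  · have hV' := hVc Finset.univ fun _ _ => Finset.mem_univ _
    rw [Finset.card_univ, Fintype.card_fin] at hV'
    calc _ ≤ 2 ^ (m - b - a) * (2 ^ (m - b - a) * M) * 4 ^ (a + b) := by gcongr
      _ = M * (4 ^ (m - b - a) * 4 ^ (a + b)) := by
        rw [show 4 = 2 * 2 by norm_num, mul_pow, mul_pow]; ring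
      _ = M * 4 ^ m := by rw [← pow_add]; congr 2; omega
  · have h0 : m - b - a = 0 := by omega
    rw [h0, pow_zero] at hUc
    rcases U.eq_empty_or_nonempty with he | ⟨u, hu⟩
    · simp [he]
    rcases V.eq_empty_or_nonempty with he | ⟨q, hq⟩
    · simp [he]
    simp only [hU, Finset.mem_filter, Finset.mem_univ, true_and] at hu
    -- On the overlap `u` forces `α = β`, so a word counted in `V` has no flipped digit there.
    have hw : ∀ p ∈ V, ∀ i : ℕ, m ≤ i + b → i < a → (p.1 : ℕ) + 1 ≤ i ∧ i < p.1 + 1 + k := by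
      intro p hp i h1 h2
      simp only [hV, Finset.mem_filter, Finset.mem_univ, true_and] at hp
      rw [← windowWord_eq_false]
      have e1 := hp.1 ⟨i, by omega⟩ h2
      have e2 := hp.2 ⟨i, by omega⟩ h1
      rw [e1, ← hu.2 ⟨i, by omega⟩ h1, hu.1 ⟨i, by omega⟩ h2] at e2
      revert e2
      cases α ⟨i, by omega⟩ <;> simp
    have hT := hVc (Finset.univ.filter fun t : Fin M => (t : ℕ) + 1 ≤ m - b ∧ m - b < t + 1 + k)
      fun p hp => by simpa using hw p hp (m - b) (by omega) (by omega)
    have hTc : (Finset.univ.filter fun t : Fin M =>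
        (t : ℕ) + 1 ≤ m - b ∧ m - b < t + 1 + k).card ≤ k := by
      calc _ ≤ (Finset.Ico (m - b - k) (m - b)).card := by
            refine Finset.card_le_card_of_injOn (fun t => (t : ℕ)) (fun t ht => ?_)
              Fin.val_injective.injOn
            simp only [Finset.coe_filter, Finset.mem_univ, true_and, mem_ofPred_eq,
              Finset.coe_Ico, mem_Ico] at ht ⊢
            omega
        _ ≤ k := by rw [Nat.card_Ico]; omega
    -- The first and last overlap positions, `m - b` and `a - 1`, lie in one window of length `k`.
    have hk' : a + b ≤ m + k := by
      have h1 := hw q hq (m - b) (by omega) (by omega)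
      have h2 := hw q hq (a - 1) (by omega) (by omega)
      omega
    rw [h0, pow_zero, one_mul] at hT
    calc _ ≤ 1 * k * 4 ^ (m + k) := by
          gcongr
          · exact hT.trans hTc
          · norm_num
      _ = k * 4 ^ k * 4 ^ m := by ring
      _ ≤ _ := by gcongr

/-! ### Sparse forms and integrable majorants -/

instance : Countable DyadicInterval :=
  Function.Injective.countable (f := fun I : DyadicInterval => (I.scale, I.index))
    fun _ _ h => DyadicInterval.ext (congrArg Prod.fst h) (congrArg Prod.snd h)

instance : Countable DyadicRectangle :=
  Function.Injective.countable (f := fun R : DyadicRectangle => (R.fst, R.snd))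
    fun _ _ h => DyadicRectangle.ext (congrArg Prod.fst h) (congrArg Prod.snd h)

namespace DyadicRectangle

theorem measurableSet_toSet (R : DyadicRectangle) : MeasurableSet R.toSet :=
  R.fst.measurableSet_toSet.prod R.snd.measurableSet_toSet

theorem volume_toSet (R : DyadicRectangle) :
    volume R.toSet = ENNReal.ofReal (R.fst.length * R.snd.length) := by
  rw [toSet, Measure.volume_eq_prod, Measure.prod_prod, DyadicInterval.volume_toSet,
    DyadicInterval.volume_toSet, ENNReal.ofReal_mul R.fst.length_pos.le]

end DyadicRectangle

/-- Each term is charged to `E R`, where `W` dominates the product of averages; disjointness lets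
the charges add up. -/
theorem mul_sparseForm_le_lintegral {η : ℝ} {S : Set DyadicRectangle} (hS : IsSparse η S)
    {f g : ℝ × ℝ → ℝ} {W : ℝ × ℝ → ℝ≥0∞}
    (hW : ∀ R : DyadicRectangle, ∀ x ∈ R.toSet, R.average f * R.average g ≤ W x) :
    ENNReal.ofReal η * sparseForm S f g ≤ ∫⁻ x, W x := by
  obtain ⟨E, hE, hd⟩ := hS
  rw [sparseForm, ← ENNReal.tsum_mul_left]
  calc _ ≤ ∑' R : S, ∫⁻ x in E R, W x := by
        refine ENNReal.tsum_le_tsum fun R => ?_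
        obtain ⟨hm, hsub, hle⟩ := hE R R.2
        calc _ = R.1.average f * R.1.average g * (ENNReal.ofReal η * volume R.1.toSet) := by ring
          _ ≤ R.1.average f * R.1.average g * volume (E R) := by gcongr
          _ = ∫⁻ x in E R, R.1.average f * R.1.average g := by rw [setLIntegral_const]
          _ ≤ _ := setLIntegral_mono' hm fun x hx => hW R x (hsub hx)
    _ = ∫⁻ x in ⋃ R : S, E R, W x :=
        (lintegral_iUnion (fun R : S => (hE R R.2).1)
          (fun R R' h => hd R.2 R'.2 (Subtype.coe_injective.ne h)) _).symm
    _ ≤ _ := setLIntegral_le_lintegral _ _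

/-- The tensor product of two Cauchy weights on the line. -/
noncomputable def cauchyWeight (x : ℝ × ℝ) : ℝ := 25 * ((1 + x.1 ^ 2)⁻¹ * (1 + x.2 ^ 2)⁻¹)

theorem lintegral_cauchyWeight :
    ∫⁻ x, ENNReal.ofReal (cauchyWeight x) = ENNReal.ofReal (25 * Real.pi ^ 2) := by
  have hi : Integrable cauchyWeight volume := by
    rw [Measure.volume_eq_prod]
    exact (integrable_inv_one_add_sq.mul_prod integrable_inv_one_add_sq).const_mul 25
  rw [← ofReal_integral_eq_lintegral_ofReal hi
    (Filter.Eventually.of_forall fun x => by simp only [cauchyWeight, Pi.zero_apply]; positivity)]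
  congr 1
  simp only [cauchyWeight]
  rw [integral_const_mul, Measure.volume_eq_prod,
    integral_prod_mul (fun x : ℝ => (1 + x ^ 2)⁻¹) (fun x : ℝ => (1 + x ^ 2)⁻¹),
    integral_univ_inv_one_add_sq, sq]

/-- Handles rectangles extending beyond the unit square: a product of two averages decays
quadratically in each side length, hence integrably. -/
theorem average_mul_average_le {f g : ℝ × ℝ → ℝ} {R : DyadicRectangle}
    (hf : ∀ x ∉ Ico (0 : ℝ) 1 ×ˢ Ico (0 : ℝ) 1, f x = 0)
    (h : (∫⁻ x in R.toSet, ‖f x‖ₑ) * (∫⁻ x in R.toSet, ‖g x‖ₑ) ≤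
      ENNReal.ofReal (((2 ^ R.fst.depth : ℝ)⁻¹ * (2 ^ R.snd.depth : ℝ)⁻¹) ^ 2))
    {x : ℝ × ℝ} (hx : x ∈ R.toSet) :
    R.average f * R.average g ≤ ENNReal.ofReal (cauchyWeight x) := by
  by_cases hne : ∃ y ∈ R.toSet, y ∈ Ico (0 : ℝ) 1 ×ˢ Ico (0 : ℝ) 1
  swap
  · have : R.average f = 0 := by
      rw [DyadicRectangle.average, setLIntegral_congr_fun (g := fun _ => 0)
        R.measurableSet_toSet (fun y hy => by simp [hf y fun h => hne ⟨y, hy, h⟩])]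
      simp
    simp [this]
  obtain ⟨y, hy, hy0⟩ := hne
  have h1 := DyadicInterval.inv_depth_le hx.1 hy.1 hy0.1
  have h2 := DyadicInterval.inv_depth_le hx.2 hy.2 hy0.2
  have l1 := R.fst.length_pos
  have l2 := R.snd.length_pos
  have hv : volume R.toSet ≠ 0 := by rw [R.volume_toSet]; simp; positivity
  have hv' : volume R.toSet ≠ ∞ := by rw [R.volume_toSet]; simp
  have hle : ((2 ^ R.fst.depth : ℝ)⁻¹ * (2 ^ R.snd.depth : ℝ)⁻¹) ^ 2 ≤
      cauchyWeight x * (R.fst.length * R.snd.length) ^ 2 := by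
    rw [mul_pow]
    refine (mul_le_mul h1 h2 (by positivity) (by positivity)).trans_eq ?_
    rw [cauchyWeight]; ring
  rw [DyadicRectangle.average, DyadicRectangle.average, div_eq_mul_inv, div_eq_mul_inv,
    mul_mul_mul_comm, ← ENNReal.mul_inv (Or.inl hv) (Or.inl hv'), ← div_eq_mul_inv]
  refine ENNReal.div_le_of_le_mul (h.trans ((ENNReal.ofReal_le_ofReal hle).trans_eq ?_))
  rw [R.volume_toSet, ENNReal.ofReal_mul (by rw [cauchyWeight]; positivity), sq,
    ENNReal.ofReal_mul (by positivity)]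

/-! ### Sums of boxes and their Haar coefficients -/

/-- The sum of the indicators of finitely many dyadic rectangles. -/
noncomputable def boxSum {ι : Type*} [Fintype ι] (B : ι → DyadicRectangle) (x : ℝ × ℝ) : ℝ :=
  ∑ j, (B j).toSet.indicator (fun _ => (1 : ℝ)) x

section boxSum

variable {ι : Type*} [Fintype ι] (B : ι → DyadicRectangle)

theorem memLp_box (R : DyadicRectangle) (p : ℝ≥0∞) :
    MemLp (R.toSet.indicator fun _ => (1 : ℝ)) p volume :=
  memLp_indicator_const p R.measurableSet_toSet 1 (Or.inr (by simp [R.volume_toSet]))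

theorem memLp_const_mul_boxSum (c : ℝ) (p : ℝ≥0∞) :
    MemLp (fun x => c * boxSum B x) p volume :=
  (memLp_finsetSum _ fun j _ => memLp_box (B j) p).const_mul c

theorem boxSum_eq_zero (hB : ∀ j, (B j).toSet ⊆ Ico (0 : ℝ) 1 ×ˢ Ico (0 : ℝ) 1) {x : ℝ × ℝ}
    (hx : x ∉ Ico (0 : ℝ) 1 ×ˢ Ico (0 : ℝ) 1) : boxSum B x = 0 :=
  Finset.sum_eq_zero fun j _ => indicator_of_notMem (fun h => hx (hB j h)) _

theorem hasCompactSupport_const_mul_boxSum (c : ℝ)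
    (hB : ∀ j, (B j).toSet ⊆ Ico (0 : ℝ) 1 ×ˢ Ico (0 : ℝ) 1) :
    HasCompactSupport fun x => c * boxSum B x :=
  HasCompactSupport.intro (isCompact_Icc.prod isCompact_Icc) fun x hx => by
    rw [boxSum_eq_zero B hB fun h => hx (prod_mono Ico_subset_Icc_self Ico_subset_Icc_self h),
      mul_zero]

theorem integral_const_mul_boxSum_mul_haar (c : ℝ) (R : DyadicRectangle) :
    ∫ x, c * boxSum B x * R.haar x = c * ∑ j, (∫ x in (B j).fst.toSet, R.fst.haar x) *
      ∫ x in (B j).snd.toSet, R.snd.haar x := by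
  have e : ∀ x, c * boxSum B x * R.haar x =
      c * ∑ j, (B j).toSet.indicator (fun _ => (1 : ℝ)) x * R.haar x := fun x => by
    rw [boxSum, mul_assoc, Finset.sum_mul]
  simp only [e]
  rw [integral_const_mul, integral_finsetSum]
  · congr 1
    refine Finset.sum_congr rfl fun j _ => ?_
    rw [← setIntegral_prod_mul, ← Measure.volume_eq_prod, ← DyadicRectangle.toSet,
      ← integral_indicator (B j).measurableSet_toSet]
    congr 1
    funext x
    by_cases hx : x ∈ (B j).toSet <;> simp [hx, DyadicRectangle.haar]
  · exact fun j _ => (memLp_box (B j) 2).integrable_mul R.memLp_haar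

theorem setLIntegral_const_mul_boxSum {c : ℝ} (hc : 0 ≤ c) (R : DyadicRectangle) :
    ∫⁻ x in R.toSet, ‖c * boxSum B x‖ₑ =
      ENNReal.ofReal c * ∑ j, volume ((B j).toSet ∩ R.toSet) := by
  have e : ∀ x, ‖c * boxSum B x‖ₑ =
      ENNReal.ofReal c * ∑ j, (B j).toSet.indicator (fun _ => (1 : ℝ≥0∞)) x := fun x => by
    have h0 : ∀ j ∈ Finset.univ, 0 ≤ (B j).toSet.indicator (fun _ => (1 : ℝ)) x :=
      fun j _ => indicator_nonneg (fun _ _ => zero_le_one) x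
    rw [boxSum, Real.enorm_of_nonneg (mul_nonneg hc (Finset.sum_nonneg h0)),
      ENNReal.ofReal_mul hc, ENNReal.ofReal_sum_of_nonneg h0]
    congr 1
    refine Finset.sum_congr rfl fun j _ => ?_
    by_cases hx : x ∈ (B j).toSet <;> simp [hx]
  have hm : ∀ j, Measurable ((B j).toSet.indicator fun _ => (1 : ℝ≥0∞)) :=
    fun j => measurable_const.indicator (B j).measurableSet_toSet
  simp only [e]
  rw [lintegral_const_mul _ (Finset.measurable_sum _ fun j _ => hm j),
    lintegral_finsetSum _ fun j _ => hm j]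
  congr 1
  refine Finset.sum_congr rfl fun j _ => ?_
  rw [lintegral_indicator (B j).measurableSet_toSet, setLIntegral_one,
    Measure.restrict_apply (B j).measurableSet_toSet]

end boxSum

/-- The martingale transform whose coefficients are the signs making all the terms with `R ∈ F`
of `⟨T f, g⟩` nonnegative. -/
theorem integral_martingaleTransform_sign_mul (F : Finset DyadicRectangle) [DecidableEq DyadicRectangle]
    {f g : ℝ × ℝ → ℝ} (hg : MemLp g 2 volume) :
    ∫ x, martingaleTransform (fun R => if R ∈ F then
        (SignType.sign ((∫ x, f x * R.haar x) * ∫ x, g x * R.haar x) : ℝ) else 0) f x * g x =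
      ∑ R ∈ F, |(∫ x, f x * R.haar x) * ∫ x, g x * R.haar x| := by
  rw [martingaleTransform, tsum_eq_sum (s := F) (fun R hR => by simp [hR])]
  set c : DyadicRectangle → ℝ := fun R => (if R ∈ F then
    (SignType.sign ((∫ x, f x * R.haar x) * ∫ x, g x * R.haar x) : ℝ) else 0) *
      ∫ x, f x * R.haar x with hc
  have hae : (fun x => (∑ R ∈ F, c R • R.memLp_haar.toLp R.haar : Lp ℝ 2 volume) x * g x)
      =ᵐ[volume] fun x => ∑ R ∈ F, c R * (g x * R.haar x) := by
    have h1 : ∀ᵐ x, ∀ R ∈ F, (c R • R.memLp_haar.toLp R.haar : Lp ℝ 2 volume) x =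
        c R * R.haar x := by
      rw [Filter.eventually_all_finset]
      intro R _
      filter_upwards [Lp.coeFn_smul (c R) (R.memLp_haar.toLp R.haar), R.memLp_haar.coeFn_toLp]
        with x h1 h2
      rw [h1, Pi.smul_apply, h2, smul_eq_mul]
    filter_upwards [Lp.coeFn_finsetSum F fun R => c R • R.memLp_haar.toLp R.haar, h1]
      with x h2 h3
    rw [h2, Finset.sum_apply, Finset.sum_mul]
    exact Finset.sum_congr rfl fun R hR => by rw [h3 R hR]; ring
  rw [integral_congr_ae hae, integral_finsetSum (f := fun R x => c R * (g x * R.haar x)) _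
    fun R _ => (hg.integrable_mul R.memLp_haar).const_mul _]
  refine Finset.sum_congr rfl fun R hR => ?_
  rw [integral_const_mul, hc]
  simp only [hR, if_true]
  rw [mul_assoc, sign_mul_self]

/-! ### Digit-reversal squares and the upper bound -/

open DyadicInterval

section Words

variable {m : ℕ}

/-- The extension of a finite word by zeros. -/
def extendWord (u : Fin m → Bool) (i : ℕ) : Bool := if h : i < m then u ⟨i, h⟩ else false

theorem extendWord_coe (u : Fin m → Bool) (i : Fin m) : extendWord u i = u i := by
  simp [extendWord]

theorem extendWord_coe_rev (u : Fin m → Bool) (i : Fin m) :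
    extendWord (u ∘ Fin.rev) i.rev = u i := by
  simp only [extendWord_coe, Function.comp_apply, Fin.rev_rev]

theorem extendWord_agree_iff {a : ℕ} (ha : a ≤ m) {u : Fin m → Bool} {α : ℕ → Bool} :
    (∀ i < a, extendWord u i = α i) ↔ ∀ i : Fin m, (i : ℕ) < a → u i = α i := by
  constructor
  · intro h i hi
    simpa [extendWord] using h i hi
  · intro h i hi
    simpa [extendWord, hi.trans_le ha] using h ⟨i, hi.trans_le ha⟩ hi

theorem extendWord_rev_agree_iff {b : ℕ} (hb : b ≤ m) {u : Fin m → Bool} {β : ℕ → Bool} :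
    (∀ i < b, extendWord (u ∘ Fin.rev) i = β i) ↔
      ∀ i : Fin m, m ≤ i + b → u i = β i.rev := by
  rw [extendWord_agree_iff hb]
  constructor
  · intro h i hi
    simpa using h i.rev (by rw [Fin.val_rev]; omega)
  · intro h i hi
    have := h i.rev (by rw [Fin.val_rev]; omega)
    rwa [Fin.rev_rev] at this

/-- The square of side `2 ^ (-m)` whose first coordinates have the digits `u`, and whose second
coordinates have the digits `v` in reverse order. -/
def wordSquare (u v : Fin m → Bool) : DyadicRectangle :=
  ⟨cell (extendWord u) m, cell (extendWord (v ∘ Fin.rev)) m⟩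

theorem wordSquare_subset (u v : Fin m → Bool) :
    (wordSquare u v).toSet ⊆ Ico (0 : ℝ) 1 ×ˢ Ico (0 : ℝ) 1 :=
  prod_mono (cell_subset_unit _ _) (cell_subset_unit _ _)

/-- The bound for the area of the intersection of `R` with a square of side `2 ^ (-m)`. -/
noncomputable def interBound (m : ℕ) (R : DyadicRectangle) : ℝ :=
  (2 ^ min R.fst.depth m : ℝ) * (2 ^ R.fst.depth : ℝ)⁻¹ * (2 ^ m : ℝ)⁻¹ *
    ((2 ^ min R.snd.depth m : ℝ) * (2 ^ R.snd.depth : ℝ)⁻¹ * (2 ^ m : ℝ)⁻¹)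

theorem volume_wordSquare_inter_le (u v : Fin m → Bool) (R : DyadicRectangle) :
    volume ((wordSquare u v).toSet ∩ R.toSet) ≤ ENNReal.ofReal (interBound m R) := by
  rw [DyadicRectangle.toSet, DyadicRectangle.toSet, prod_inter_prod, Measure.volume_eq_prod,
    Measure.prod_prod, interBound, ENNReal.ofReal_mul (by positivity)]
  exact mul_le_mul' (volume_cell_inter_le _ _ _) (volume_cell_inter_le _ _ _)

theorem setLIntegral_wordSquares_le {ι : Type*} [Fintype ι] {c : ℝ} (hc : 0 ≤ c)
    (U V : ι → Fin m → Bool) (R : DyadicRectangle) (s : Finset ι)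
    (hs : ∀ j, ((wordSquare (U j) (V j)).toSet ∩ R.toSet).Nonempty → j ∈ s) :
    ∫⁻ x in R.toSet, ‖c * boxSum (fun j => wordSquare (U j) (V j)) x‖ₑ ≤
      ENNReal.ofReal (c * (s.card * interBound m R)) := by
  rw [setLIntegral_const_mul_boxSum _ hc, ENNReal.ofReal_mul hc,
    ENNReal.ofReal_mul (Nat.cast_nonneg _), ENNReal.ofReal_natCast]
  gcongr
  rw [← Finset.sum_subset (Finset.subset_univ s) fun j _ hj => by
    rw [not_nonempty_iff_eq_empty.1 fun h => hj (hs j h), measure_empty], ← nsmul_eq_mul]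
  exact Finset.sum_le_card_nsmul _ _ _ fun j _ => volume_wordSquare_inter_le _ _ _

/-- The word `u` with all digits flipped outside of the window `t + 1, …, t + k`. -/
def shiftWord (k t : ℕ) (u : Fin m → Bool) (i : Fin m) : Bool := xor (u i) (windowWord k t i)

/-- The normalized indicator of the squares whose digits agree up to the reversal. -/
noncomputable def netFun (m : ℕ) (x : ℝ × ℝ) : ℝ :=
  2 ^ m * boxSum (fun u : Fin m → Bool => wordSquare u u) x

/-- The average of the normalized indicators of the squares whose digits, up to the reversal,
agree exactly at a window of length `k`. -/
noncomputable def windowFun (k M m : ℕ) (x : ℝ × ℝ) : ℝ :=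
  2 ^ m / M * boxSum (fun p : Fin M × (Fin m → Bool) => wordSquare p.2 (shiftWord k p.1 p.2)) x

/-- Here `x, y` stand for the two counts, `z` for `2 ^ m`, `p, q` for the powers of 2 at the
truncated depths, and `d, e` for the inverse powers at the full depths. -/
theorem mul_interBound_le {M x y p q z d e : ℝ} (hM : 0 < M) (hz : 0 < z)
    (h : x * y * (p * q) ^ 2 ≤ M * z ^ 2) :
    z * (x * (p * d * z⁻¹ * (q * e * z⁻¹))) * (z / M * (y * (p * d * z⁻¹ * (q * e * z⁻¹)))) ≤
      (d * e) ^ 2 := by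
  calc _ = (x * y * (p * q) ^ 2) * ((d * e) ^ 2 / (M * z ^ 2)) := by field_simp
    _ ≤ (M * z ^ 2) * ((d * e) ^ 2 / (M * z ^ 2)) := by gcongr
    _ = _ := by field_simp

theorem exists_finset_wordSquare_inter {k M : ℕ} (hk : k * 4 ^ k ≤ M) (R : DyadicRectangle) :
    ∃ (U : Finset (Fin m → Bool)) (V : Finset (Fin M × (Fin m → Bool))),
      (∀ u, ((wordSquare u u).toSet ∩ R.toSet).Nonempty → u ∈ U) ∧
      (∀ p, ((wordSquare p.2 (shiftWord k p.1 p.2)).toSet ∩ R.toSet).Nonempty → p ∈ V) ∧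
      U.card * V.card * 4 ^ (min R.fst.depth m + min R.snd.depth m) ≤ M * 4 ^ m := by
  obtain ⟨α, hα⟩ := R.fst.exists_digits m
  obtain ⟨β, hβ⟩ := R.snd.exists_digits m
  have key : ∀ u v : Fin m → Bool, ((wordSquare u v).toSet ∩ R.toSet).Nonempty →
      (∀ i : Fin m, (i : ℕ) < min R.fst.depth m → u i = α i) ∧
      ∀ i : Fin m, m ≤ i + min R.snd.depth m → v i = β i.rev := by
    rintro u v ⟨x, hx, hxR⟩
    exact ⟨(extendWord_agree_iff (min_le_right _ _)).1 (hα _ ⟨x.1, hx.1, hxR.1⟩),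
      (extendWord_rev_agree_iff (min_le_right _ _)).1 (hβ _ ⟨x.2, hx.2, hxR.2⟩)⟩
  exact ⟨_, _, fun u hu => Finset.mem_filter.2 ⟨Finset.mem_univ _, key _ _ hu⟩,
    fun p hp => Finset.mem_filter.2 ⟨Finset.mem_univ _, key _ _ hp⟩,
    card_mul_card_le hk (min_le_right R.fst.depth m) (min_le_right R.snd.depth m)
      (fun i => α i) fun i => β i.rev⟩

theorem setLIntegral_netFun_mul_windowFun_le {k M : ℕ} (hM : 0 < M) (hk : k * 4 ^ k ≤ M)
    (R : DyadicRectangle) :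
    (∫⁻ x in R.toSet, ‖netFun m x‖ₑ) * (∫⁻ x in R.toSet, ‖windowFun k M m x‖ₑ) ≤
      ENNReal.ofReal (((2 ^ R.fst.depth : ℝ)⁻¹ * (2 ^ R.snd.depth : ℝ)⁻¹) ^ 2) := by
  obtain ⟨U, V, hU, hV, hcard⟩ := exists_finset_wordSquare_inter (m := m) hk R
  have hf := setLIntegral_wordSquares_le (c := 2 ^ m) (by positivity) _ _ R U hU
  have hg := setLIntegral_wordSquares_le (c := 2 ^ m / M) (by positivity) _ _ R V hV
  refine (mul_le_mul' hf hg).trans ?_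
  rw [← ENNReal.ofReal_mul (by rw [interBound]; positivity)]
  apply ENNReal.ofReal_le_ofReal
  clear hf hg hU hV
  generalize U.card = x at hcard ⊢
  generalize V.card = y at hcard ⊢
  have hcard' : (x * y * (2 ^ min R.fst.depth m * 2 ^ min R.snd.depth m) ^ 2 : ℝ) ≤
      M * (2 ^ m) ^ 2 := by
    have : ((x * y * 4 ^ (min R.fst.depth m + min R.snd.depth m) : ℕ) : ℝ) ≤
      (M * 4 ^ m : ℕ) := by exact_mod_cast hcard
    push_cast at this
    rw [show (4 : ℝ) = 2 ^ 2 by norm_num, ← pow_mul, ← pow_mul, mul_comm 2, mul_comm 2, pow_mul,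
      pow_mul, pow_add] at this
    exact this
  rw [interBound]
  exact mul_interBound_le (by exact_mod_cast hM) (by positivity) hcard'

/-! ### Test rectangles and the lower bound -/

/-- The rectangle of the points whose first digits are the first `t + 1 + k` digits of `u`, and
the last `m - (t + 1)` digits of `u` in reverse order. -/
def testRectangle (k t : ℕ) (u : Fin m → Bool) : DyadicRectangle :=
  ⟨cell (extendWord u) (t + 1 + k), cell (extendWord (u ∘ Fin.rev)) (m - (t + 1))⟩

/-- Cells are nested or disjoint, so a wrong digit puts the square outside the test rectangle. -/
theorem setIntegral_haar_wordSquare_eq_zero {k t : ℕ} (ht : t + 1 + k < m)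
    (u v w : Fin m → Bool) (h : ¬ ((∀ i : Fin m, (i : ℕ) < t + 1 + k → v i = u i) ∧
      ∀ i : Fin m, t + 1 ≤ (i : ℕ) → w i = u i)) :
    (∫ x in (wordSquare v w).fst.toSet, (testRectangle k t u).fst.haar x) *
      ∫ x in (wordSquare v w).snd.toSet, (testRectangle k t u).snd.haar x = 0 := by
  contrapose! h
  constructor
  · have := mt (setIntegral_haar_cell_eq_zero ht.le) (left_ne_zero_of_mul h)
    rw [not_not, extendWord_agree_iff ht.le] at this
    simpa only [extendWord_coe] using this
  · have := mt (setIntegral_haar_cell_eq_zero (Nat.sub_le _ _)) (right_ne_zero_of_mul h)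
    rw [not_not, extendWord_rev_agree_iff (Nat.sub_le _ _)] at this
    intro i hi
    simpa only [extendWord_coe_rev] using this i (by omega)

theorem abs_setIntegral_haar_wordSquare {k t : ℕ} (ht : t + 1 + k < m)
    {u v w : Fin m → Bool} (h1 : ∀ i : Fin m, (i : ℕ) < t + 1 + k → v i = u i)
    (h2 : ∀ i : Fin m, t + 1 ≤ (i : ℕ) → w i = u i) :
    |(∫ x in (wordSquare v w).fst.toSet, (testRectangle k t u).fst.haar x) *
      ∫ x in (wordSquare v w).snd.toSet, (testRectangle k t u).snd.haar x| =
      Real.sqrt (2 ^ k * 2 ^ m) * ((2 ^ m)⁻¹) ^ 2 := by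
  have e1 := setIntegral_haar_cell (u := extendWord u) (v := extendWord v) ht
    ((extendWord_agree_iff ht.le).2 fun i hi => by rw [h1 i hi, extendWord_coe])
  have e2 := setIntegral_haar_cell (u := extendWord (u ∘ Fin.rev)) (v := extendWord (w ∘ Fin.rev))
    (show m - (t + 1) < m by omega) ((extendWord_rev_agree_iff (Nat.sub_le _ _)).2 fun i hi => by
      rw [h2 i (by omega), extendWord_coe_rev])
  rw [wordSquare, testRectangle, abs_mul, e1, e2, length_cell, length_cell, Real.sqrt_inv,
    Real.sqrt_inv, inv_inv, inv_inv, ← pow_add, show k + m = (t + 1 + k) + (m - (t + 1)) by omega,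
    pow_add _ (t + 1 + k), Real.sqrt_mul (by positivity)]
  generalize Real.sqrt (2 ^ (t + 1 + k)) = p
  generalize Real.sqrt (2 ^ (m - (t + 1))) = q
  ring

/-- Prefix and suffix together cover every position, so only the square of `u` itself contributes.
-/
theorem abs_integral_netFun_mul_haar {k t : ℕ} (ht : t + 1 + k < m) (u : Fin m → Bool) :
    |∫ x, netFun m x * (testRectangle k t u).haar x| =
      2 ^ m * (Real.sqrt (2 ^ k * 2 ^ m) * ((2 ^ m)⁻¹) ^ 2) := by
  simp only [netFun]
  rw [integral_const_mul_boxSum_mul_haar, Finset.sum_eq_single u, abs_mul,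
    abs_setIntegral_haar_wordSquare ht (fun _ _ => rfl) (fun _ _ => rfl),
    abs_of_nonneg (by positivity)]
  · refine fun v _ hv => setIntegral_haar_wordSquare_eq_zero ht _ _ _ fun h => hv (funext fun i => ?_)
    rcases lt_or_ge (i : ℕ) (t + 1 + k) with hi | hi
    · exact h.1 i hi
    · exact h.2 i (by omega)
  · simp

theorem abs_integral_windowFun_mul_haar {k M : ℕ} (t : Fin M) (hk : 0 < k) (hm : M + k < m)
    (u : Fin m → Bool) :
    |∫ x, windowFun k M m x * (testRectangle k t u).haar x| =
      2 ^ m / M * (Real.sqrt (2 ^ k * 2 ^ m) * ((2 ^ m)⁻¹) ^ 2) := by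
  have ht : (t : ℕ) + 1 + k < m := by omega
  simp only [windowFun]
  -- The only contributing word: it keeps the prefix of `u`, and past the window it is flipped so
  -- that the shift restores `u`.
  rw [integral_const_mul_boxSum_mul_haar, Finset.sum_eq_single
    (t, fun i : Fin m => if (i : ℕ) < t + 1 + k then u i else !u i), abs_mul,
    abs_setIntegral_haar_wordSquare ht, abs_of_nonneg (by positivity)]
  · intro i hi
    simp [hi]
  · intro i hi
    by_cases h : (i : ℕ) < t + 1 + k
    · simp [shiftWord, h, windowWord_eq_false.2 ⟨hi, h⟩]
    · simp [shiftWord, windowWord, h]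
  · rintro ⟨s, v⟩ _ hv
    refine setIntegral_haar_wordSquare_eq_zero ht _ _ _ fun h => hv ?_
    have hw : ∀ i : ℕ, (t : ℕ) + 1 ≤ i → i < t + 1 + k → (s : ℕ) + 1 ≤ i ∧ i < s + 1 + k := by
      intro i h1 h2
      rw [← windowWord_eq_false]
      have e1 := h.1 ⟨i, by omega⟩ h2
      have e2 := h.2 ⟨i, by omega⟩ h1
      simp only [shiftWord] at e1 e2
      rw [e1] at e2
      revert e2
      cases u ⟨i, by omega⟩ <;> simp
    -- Window `s` contains window `t` and has the same length; `0 < k` makes both endpoints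
    -- available.
    have hst : s = t := by
      have h1 := hw (t + 1) le_rfl (by omega)
      have h2 := hw (t + k) (by omega) (by omega)
      exact Fin.ext (by omega)
    subst hst
    refine Prod.ext rfl (funext fun i => ?_)
    by_cases hi : (i : ℕ) < s + 1 + k
    · simpa [hi] using h.1 i hi
    · have := h.2 i (by omega)
      simp [shiftWord, windowWord, hi] at this
      simp [hi, ← this]
  · simp

theorem testRectangle_injective {k M : ℕ} (hm : M + k < m) :
    Function.Injective fun p : Fin M × (Fin m → Bool) => testRectangle k p.1 p.2 := by
  rintro ⟨s, u⟩ ⟨t, v⟩ h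
  simp only [testRectangle, DyadicRectangle.mk.injEq] at h
  have hst : s = t := by
    have := congrArg DyadicInterval.scale h.1
    simp only [cell] at this
    exact Fin.ext (by omega)
  subst hst
  rw [cell_eq_iff, cell_eq_iff, extendWord_agree_iff (by omega),
    extendWord_rev_agree_iff (by omega)] at h
  refine Prod.ext rfl (funext fun i => ?_)
  rcases lt_or_ge (i : ℕ) (s + 1 + k) with hi | hi
  · simpa only [extendWord_coe] using h.1 i hi
  · simpa only [extendWord_coe_rev] using h.2 i (by omega)

end Words

/-! ### Choice of parameters and conclusion -/

theorem mainTheorem7 (C η : ℝ) (hC : 0 < C) (hη : 0 < η) (hη1 : η ≤ 1) :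
    ∃ σ : DyadicRectangle → ℝ, (∀ R, |σ R| ≤ 1) ∧
      ∃ f g : ℝ × ℝ → ℝ,
        (MemLp f ∞ volume ∧ HasCompactSupport f) ∧
        (MemLp g ∞ volume ∧ HasCompactSupport g) ∧
        ∀ S : Set DyadicRectangle, IsSparse η S →
          ENNReal.ofReal C * sparseForm S f g <
            ENNReal.ofReal |∫ x, martingaleTransform σ f x * g x| := by
  classical
  -- The pairing `2 ^ k` must beat `C` times the weight's integral over `η`; the extra 1 rules out
  -- `k = 0`.
  obtain ⟨k, hk⟩ := pow_unbounded_of_one_lt (C * (25 * Real.pi ^ 2 / η) + 1) (one_lt_two (α := ℝ))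
  have hX : 0 < C * (25 * Real.pi ^ 2 / η) := by positivity
  have hk0 : 0 < k := by
    rcases Nat.eq_zero_or_pos k with rfl | h
    · norm_num at hk; linarith
    · exact h
  set M := k * 4 ^ k with hMdef
  have hM : 0 < M := by positivity
  -- Makes `t + 1 + k < m` for all `t < M`, so both sides of every test rectangle are strictly
  -- longer than the squares.
  set m := M + k + 1 with hm
  set f := netFun m
  set g := windowFun k M m
  set F : Finset DyadicRectangle := Finset.univ.image
    fun p : Fin M × (Fin m → Bool) => testRectangle k p.1 p.2 with hF
  have hpair := integral_martingaleTransform_sign_mul F (f := f) (g := g)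
    (memLp_const_mul_boxSum _ _ 2)
  have hsum : ∑ R ∈ F, |(∫ x, f x * R.haar x) * ∫ x, g x * R.haar x| = 2 ^ k := by
    rw [hF, Finset.sum_image (testRectangle_injective (by omega)).injOn]
    have hterm : ∀ p : Fin M × (Fin m → Bool),
        |(∫ x, f x * (testRectangle k p.1 p.2).haar x) *
          ∫ x, g x * (testRectangle k p.1 p.2).haar x| = 2 ^ k / (M * 2 ^ m) := fun p => by
      rw [abs_mul, abs_integral_netFun_mul_haar (by omega),
        abs_integral_windowFun_mul_haar p.1 hk0 (by omega)]
      have hs := Real.mul_self_sqrt (show (0 : ℝ) ≤ 2 ^ k * 2 ^ m by positivity)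
      generalize Real.sqrt (2 ^ k * 2 ^ m) = r at *
      have hz : (0 : ℝ) < 2 ^ m := by positivity
      generalize (2 : ℝ) ^ m = z at *
      calc _ = r * r * (z / M * z * (z⁻¹) ^ 4) := by ring
        _ = _ := by rw [hs]; field_simp
    simp only [hterm]
    have hM' : (M : ℝ) ≠ 0 := by positivity
    rw [Finset.sum_const, Finset.card_univ, Fintype.card_prod, Fintype.card_fin, Fintype.card_fun,
      Fintype.card_bool, Fintype.card_fin, nsmul_eq_mul]
    push_cast
    field_simp
  rw [hsum] at hpair
  refine ⟨fun R => if R ∈ F then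
    (SignType.sign ((∫ x, f x * R.haar x) * ∫ x, g x * R.haar x) : ℝ) else 0, fun R => ?_, f, g, ⟨memLp_const_mul_boxSum _ _ _,
    hasCompactSupport_const_mul_boxSum _ _ fun u => wordSquare_subset _ _⟩,
    ⟨memLp_const_mul_boxSum _ _ _,
    hasCompactSupport_const_mul_boxSum _ _ fun u => wordSquare_subset _ _⟩, fun S hS => ?_⟩
  rotate_left
  · rw [hpair]
    have hbound := mul_sparseForm_le_lintegral hS (f := f) (g := g) fun R x hx =>
      average_mul_average_le (fun x hx => by
        simp only [netFun]
        rw [boxSum_eq_zero _ (fun u => wordSquare_subset _ _) hx, mul_zero])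
        (setLIntegral_netFun_mul_windowFun_le hM le_rfl R) hx
    rw [lintegral_cauchyWeight] at hbound
    have hη' : ENNReal.ofReal η ≠ 0 := by simpa using hη
    have hle : sparseForm S f g ≤ ENNReal.ofReal (25 * Real.pi ^ 2 / η) := by
      rw [ENNReal.ofReal_div_of_pos hη, ENNReal.le_div_iff_mul_le (Or.inl hη')
        (Or.inl ENNReal.ofReal_ne_top), mul_comm]
      exact hbound
    calc _ ≤ ENNReal.ofReal C * ENNReal.ofReal (25 * Real.pi ^ 2 / η) := by gcongr
      _ = ENNReal.ofReal (C * (25 * Real.pi ^ 2 / η)) := (ENNReal.ofReal_mul hC.le).symm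
      _ < _ := by
        rw [abs_of_pos (by positivity), ENNReal.ofReal_lt_ofReal_iff (by positivity)]
        linarith
  · dsimp only
    split_ifs
    · rcases SignType.sign ((∫ x, f x * R.haar x) * ∫ x, g x * R.haar x) <;> simp
    · simp
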